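/- Let $\lambda\supset\mu$ be partitions (possibly empty), identified with their Young diagrams $D(\lambda)\supset D(\mu)$, with conjugates $\lambda',\mu'$; put $D(\lambda/\mu)=D(\lambda)\setminus D(\mu)$. Let $p$ and $q$ be the numbers of diagonal boxes of $\lambda$ and $\mu$, and write them in Frobenius notation $\lambda=(\alpha_1,\dots,\alpha_p\,|\,\beta_1,\dots,\beta_p)$, $\mu=(\gamma_1,\dots,\gamma_q\,|\,\delta_1,\dots,\delta_q)$, i.e. $\alpha_i=\lambda_i-i$, $\beta_i=\lambda'_i-i$, $\gamma_i=\mu_i-i$, $\delta_i=\mu'_i-i$. In particular, for integers $x,y\ge0$, $(x\,|\,y)$ is the hook partition $(x+1,1^{y})$. Let $M\ge 0$ be an integer and $\boldsymbol a=(a_c)_{c\in\mathbb Z}$ a sequence of complex numbers, and put $\tau^m\boldsymbol a=(a_{c+m})_{c\in\mathbb Z}$ for $m\in\mathbb Z$. Let $$\zeta^M_{\lambda/\mu}(\boldsymbol a)=\sum_{(t_{i,j})}\ \prod_{(i,j)\in D(\lambda/\mu)}t_{i,j}^{-a_{j-i}},$$ where the sum runs over all semistandard tableaux of shape $\lambda/\mu$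 (weakly increasing along rows, strictly increasing down columns) with entries in $\{1,\dots,M\}$; write $\zeta^M_{\lambda}$ for $\zeta^M_{\lambda/\varnothing}$. For $d\ge 0$ let $$\zeta^{\star,M}_d(\boldsymbol a)=\sum_{1\le m_1\le\cdots\le m_d\le M}\frac{1}{m_1^{a_0}m_2^{a_1}\cdots m_d^{a_{d-1}}},\qquad \zeta^{M}_d(\boldsymbol a)=\sum_{1\le m_1<\cdots<m_d\le M}\frac{1}{m_1^{a_0}m_2^{a_{-1}}\cdots m_d^{a_{-(d-1)}}}$$ (both equal to $1$ for $d=0$), and let $\zeta^{\star,M}_d(\boldsymbol a)=\zeta^M_d(\boldsymbol a)=0$ for $d<0$. Then $$\zeta^{M}_{\lambda/\mu}(\boldsymbol a)=(-1)^q\det\left[\begin{array}{c|c} \left[\zeta^{M}_{(\alpha_i|\beta_j)}(\boldsymbol a)\right]_{1\le i\le p,\ 1\le j\le p} & \left[\zeta^{\star,M}_{\alpha_i-\gamma_j}(\tau^{\gamma_j+1}\boldsymbol a)\right]_{1\le i\le p,\ 1\le j\le q}\\[6pt] \hline \left[\zeta^{M}_{\beta_j-\delta_i}(\tau^{-\delta_i-1}\boldsymbol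 a)\right]_{1\le i\le q,\ 1\le j\le p} & O_q \end{array}\right],$$ where $O_q$ is the $q\times q$ zero matrix. -/

import Mathlib

noncomputable section

namespace SchurZeta

open Finset

/-! Rows and columns of a `YoungDiagram` are numbered from `0`, so the box numbered `(i, j)` from `1` is the
cell `(i - 1, j - 1)`; contents `j - i` are unaffected. -/

/-- The set of boxes of the skew Young diagram `lam / mu`. -/
abbrev skewCells (lam mu : YoungDiagram) : Finset (ℕ × ℕ) := lam.cells \ mu.cells

/-- Fillings of the boxes of `lam / mu` by elements of `S`. -/
abbrev SkewTableau (lam mu : YoungDiagram) (S : Type*) : Type _ := skewCells lam mu → S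

/-- The content `j - i` of the box `(i, j)`. -/
def content (c : ℕ × ℕ) : ℤ := (c.2 : ℤ) - (c.1 : ℤ)

/-- Semistandard fillings: `t i j ≤ t i (j + 1)` and `t i j < t (i + 1) j`
whenever both boxes belong to `lam / mu`. -/
def IsSemistandard {lam mu : YoungDiagram} (t : SkewTableau lam mu ℕ) : Prop :=
  (∀ u v : skewCells lam mu, v.1 = (u.1.1, u.1.2 + 1) → t u ≤ t v) ∧
  (∀ u v : skewCells lam mu, v.1 = (u.1.1 + 1, u.1.2) → t u < t v)

open Classical in
/-- The semistandard tableaux of shape `lam / mu` with entries in `{1, …, M}`. -/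
def ssyt (M : ℕ) (lam mu : YoungDiagram) : Finset (SkewTableau lam mu ℕ) :=
  (Fintype.piFinset fun _ => Icc 1 M).filter IsSemistandard

/-- The `M`-truncated Schur multiple zeta function of shape `lam / mu`. -/
def schurZeta (M : ℕ) (lam mu : YoungDiagram) (s : SkewTableau lam mu ℂ) : ℂ :=
  ∑ t ∈ ssyt M lam mu, ∏ u, ((t u : ℕ) : ℂ) ^ (-(s u))

/-- The diagonally constant index of shape `lam / mu` given by the sequence `a`. -/
def diagIndex (a : ℤ → ℂ) (lam mu : YoungDiagram) : SkewTableau lam mu ℂ :=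
  fun u => a (content u.1)

/-- The truncated Schur multiple zeta value with a diagonally constant index. -/
def diagZeta (M : ℕ) (lam mu : YoungDiagram) (a : ℤ → ℂ) : ℂ :=
  schurZeta M lam mu (diagIndex a lam mu)

/-- The shift `τ ^ m a = (a (c + m))_c`. -/
def shift (m : ℤ) (a : ℤ → ℂ) : ℤ → ℂ := fun c => a (c + m)

open Classical in
/-- `∑_{1 ≤ m_1 ≤ ⋯ ≤ m_d ≤ M} 1 / (m_1 ^ s_1 ⋯ m_d ^ s_d)`. -/
def zetaStar (M : ℕ) {d : ℕ} (s : Fin d → ℂ) : ℂ :=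
  ∑ m ∈ (Fintype.piFinset fun _ : Fin d => Icc 1 M).filter Monotone,
    ∏ i, 1 / ((m i : ℕ) : ℂ) ^ (s i)

open Classical in
/-- `∑_{1 ≤ m_1 < ⋯ < m_d ≤ M} 1 / (m_1 ^ s_1 ⋯ m_d ^ s_d)`. -/
def zeta (M : ℕ) {d : ℕ} (s : Fin d → ℂ) : ℂ :=
  ∑ m ∈ (Fintype.piFinset fun _ : Fin d => Icc 1 M).filter StrictMono,
    ∏ i, 1 / ((m i : ℕ) : ℂ) ^ (s i)

/-- `ζ^{⋆,M}_d(a) = ζ^{⋆,M}(a_0, a_1, …, a_{d-1})`, the contents along a row of length `d`;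
it is `1` for `d = 0` and, by convention, `0` for `d < 0`. -/
def rowZetaStar (M : ℕ) (d : ℤ) (a : ℤ → ℂ) : ℂ :=
  if d < 0 then 0 else zetaStar M fun i : Fin d.toNat => a (i : ℕ)

/-- `ζ^M_d(a) = ζ^M(a_0, a_{-1}, …, a_{-(d-1)})`, the contents down a column of length `d`;
it is `1` for `d = 0` and, by convention, `0` for `d < 0`. -/
def colZeta (M : ℕ) (d : ℤ) (a : ℤ → ℂ) : ℂ :=
  if d < 0 then 0 else zeta M fun i : Fin d.toNat => a (-((i : ℕ) : ℤ))

/-- The number of diagonal boxes, i.e. the length of the Frobenius notation. -/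
def diagLen (lam : YoungDiagram) : ℕ := (lam.cells.filter fun c => c.1 = c.2).card

/-- The `i`-th arm length in the Frobenius notation (`i` from `0`): the length of row `i`
minus `i + 1`, no truncation taking place for `i < diagLen lam`. -/
def frobArm (lam : YoungDiagram) (i : Fin (diagLen lam)) : ℕ := lam.rowLen i - (i + 1)

/-- The `i`-th leg length in the Frobenius notation (`i` from `0`): the length of column `i`
minus `i + 1`, no truncation taking place for `i < diagLen lam`. -/
def frobLeg (lam : YoungDiagram) (i : Fin (diagLen lam)) : ℕ := lam.colLen i - (i + 1)

/-- The diagonal boxes are exactly the `(i, i)` with `i < diagLen lam`. -/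
theorem lt_diagLen_iff (lam : YoungDiagram) (i : ℕ) : i < diagLen lam ↔ (i, i) ∈ lam := by
  have himg : ∀ k, (∀ j, (j, j) ∈ lam ↔ j < k) → diagLen lam = k := by
    intro k hk
    have : lam.cells.filter (fun c => c.1 = c.2) = (range k).image fun j => (j, j) := by
      ext ⟨x, y⟩
      simp only [mem_filter, YoungDiagram.mem_cells, mem_image, mem_range, Prod.mk.injEq]
      constructor
      · rintro ⟨h, rfl⟩
        exact ⟨x, (hk x).1 h, rfl, rfl⟩
      · rintro ⟨j, hj, rfl, rfl⟩
        exact ⟨(hk j).2 hj, rfl⟩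
    rw [diagLen, this, card_image_of_injective _ (fun a b h => (Prod.mk.inj h).1), card_range]
  have hex : ∃ k, (k, k) ∉ lam :=
    ⟨lam.rowLen 0, fun h => absurd (YoungDiagram.mem_iff_lt_rowLen.1
      (lam.up_left_mem (Nat.zero_le _) le_rfl h)) (lt_irrefl _)⟩
  classical
  have hk := himg (Nat.find hex) fun j => ⟨fun h => by
      by_contra hc
      exact Nat.find_spec hex (lam.up_left_mem (not_lt.1 hc) (not_lt.1 hc) h),
    fun h => not_not.1 (Nat.find_min hex h)⟩
  rw [hk]
  exact ⟨fun h => not_not.1 (Nat.find_min hex h), fun h => by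
    by_contra hc
    exact Nat.find_spec hex (lam.up_left_mem (not_lt.1 hc) (not_lt.1 hc) h)⟩

/-- The hook `(a | b)`: a corner box with `a` boxes to its right and `b` boxes below it. -/
def hook (a b : ℕ) : YoungDiagram where
  cells := {0} ×ˢ range (a + 1) ∪ range (b + 1) ×ˢ {0}
  isLowerSet := by
    rintro ⟨x, y⟩ ⟨z, w⟩ ⟨h1, h2⟩ h
    simp only [coe_union, coe_product, Set.mem_union, Set.mem_prod, coe_singleton,
      Set.mem_singleton_iff, coe_range, Set.mem_Iio] at h h1 h2 ⊢
    omega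

/-- The `(p + q) × (p + q)` block matrix of the skew Giambelli formula, where `p` and `q` are the
lengths of the Frobenius notations `(α | β)` of `lam` and `(γ | δ)` of `mu`. -/
def giambelliMatrix (M : ℕ) (lam mu : YoungDiagram) (a : ℤ → ℂ) :
    Matrix (Fin (diagLen lam) ⊕ Fin (diagLen mu)) (Fin (diagLen lam) ⊕ Fin (diagLen mu)) ℂ :=
  Matrix.fromBlocks
    (Matrix.of fun i j => diagZeta M (hook (frobArm lam i) (frobLeg lam j)) ⊥ a)
    (Matrix.of fun i j => rowZetaStar M ((frobArm lam i : ℤ) - (frobArm mu j : ℤ))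
      (shift ((frobArm mu j : ℤ) + 1) a))
    (Matrix.of fun i j => colZeta M ((frobLeg lam j : ℤ) - (frobLeg mu i : ℤ))
      (shift (-(frobLeg mu i : ℤ) - 1) a))
    0

end SchurZeta

end

noncomputable section

namespace SchurZeta

open Finset

/-! The formula is deduced from a Jacobi–Trudi determinant by linear algebra.

Weights depend only on contents, so a row of boxes enters only through the contents at its two ends.
`diagZeta_eq_det` expresses the zeta value as a determinant of row sums running from the row ends of
`mu` to those of `lam`. Its proof is an induction on `M`: deleting the boxes with entry `M + 1`
removes a horizontal strip (`diagZeta_succ`), and row operations produce the same sum over strips on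
the determinant side (`det_rowSum_succ`).

If `lam` has at most `n` rows, its row ends are the arm lengths together with the numbers `-1 - k`,
where `k < n` is not a leg length; likewise for `mu`. After a permutation of rows and columns, with
sign governed by the leg lengths (`sign_legPerm`), the Jacobi–Trudi matrix thus differs from the
fixed unitriangular `rowMatrix` only in the rows numbered by the legs of `lam` and the columns
numbered by the legs of `mu`. The inverse of `rowMatrix` consists of signed column sums
(`colMatrix_mul_rowMatrix`), so the matrix determinant lemma (`det_replace_rows_cols`) reduces the
determinant to size `p + q`. The entries of its first block are recognised as hooks by applying the
same reduction to a hook over the empty diagram, where the matrix is `1 × 1` (`diagZeta_hook`). -/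

/-! ### Recursion in `M` for the one-row and one-column sums. -/

theorem zetaStar_fin_zero (M : ℕ) (s : Fin 0 → ℂ) : zetaStar M s = 1 := by
  classical
  have : (Fintype.piFinset fun _ : Fin 0 => Icc 1 M).filter Monotone = univ := by
    ext m
    simp [Subsingleton.monotone]
  rw [zetaStar, this]
  simp

theorem zeta_fin_zero (M : ℕ) (s : Fin 0 → ℂ) : zeta M s = 1 := by
  classical
  have : (Fintype.piFinset fun _ : Fin 0 => Icc 1 M).filter StrictMono = univ := by
    ext m
    simp [Subsingleton.strictMono]
  rw [zeta, this]
  simp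

theorem zetaStar_zero_succ {d : ℕ} (s : Fin (d + 1) → ℂ) : zetaStar 0 s = 0 := by
  simp [zetaStar]

theorem zeta_zero_succ {d : ℕ} (s : Fin (d + 1) → ℂ) : zeta 0 s = 0 := by
  simp [zeta]

/-- Splitting the sum according to whether the largest summation variable is `M + 1`. -/
theorem zetaStar_succ (M : ℕ) {d : ℕ} (s : Fin (d + 1) → ℂ) :
    zetaStar (M + 1) s = zetaStar M s +
      1 / ((M + 1 : ℕ) : ℂ) ^ (s (Fin.last d)) * zetaStar (M + 1) fun i => s i.castSucc := by
  classical
  rw [zetaStar, ← sum_filter_not_add_sum_filter _ (fun m => m (Fin.last d) = M + 1)]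
  congr 1
  · rw [zetaStar]
    apply sum_congr _ fun _ _ => rfl
    ext m
    simp only [mem_filter, Fintype.mem_piFinset, mem_Icc]
    constructor
    · rintro ⟨⟨h, hm⟩, hl⟩
      refine ⟨fun i => ⟨(h i).1, ?_⟩, hm⟩
      have := hm (Fin.le_last i)
      have := h (Fin.last d)
      omega
    · rintro ⟨h, hm⟩
      refine ⟨⟨fun i => ⟨(h i).1, by have := h i; omega⟩, hm⟩, ?_⟩
      have := h (Fin.last d)
      omega
  · rw [zetaStar, mul_sum]
    refine sum_bij' (fun m _ => Fin.init m) (fun m _ => Fin.snoc m (M + 1)) ?_ ?_ ?_ ?_ ?_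
    · intro m hm
      simp only [mem_filter, Fintype.mem_piFinset] at hm ⊢
      exact ⟨fun i => hm.1.1 _, fun i j hij => hm.1.2 (by simpa using hij)⟩
    · intro m hm
      simp only [mem_filter, Fintype.mem_piFinset, mem_Icc] at hm ⊢
      refine ⟨⟨fun i => ?_, fun i j hij => ?_⟩, by simp⟩
      · induction i using Fin.lastCases with
        | last => simp
        | cast i => simpa using hm.1 i
      · induction j using Fin.lastCases with
        | last =>
          induction i using Fin.lastCases with
          | last => simp
          | cast i => simpa using (hm.1 i).2
        | cast j =>
          induction i using Fin.lastCases with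
          | last => exact absurd hij (by simp)
          | cast i => simpa using hm.2 (by simpa using hij)
    · intro m hm
      rw [mem_filter] at hm
      rw [← hm.2, Fin.snoc_init_self]
    · intro m _
      simp
    · intro m hm
      rw [mem_filter] at hm
      rw [Fin.prod_univ_castSucc, hm.2, mul_comm]
      rfl

/-- Splitting the sum according to whether the largest summation variable is `M + 1`. -/
theorem zeta_succ (M : ℕ) {d : ℕ} (s : Fin (d + 1) → ℂ) :
    zeta (M + 1) s = zeta M s +
      1 / ((M + 1 : ℕ) : ℂ) ^ (s (Fin.last d)) * zeta M fun i => s i.castSucc := by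
  classical
  rw [zeta, ← sum_filter_not_add_sum_filter _ (fun m => m (Fin.last d) = M + 1)]
  congr 1
  · rw [zeta]
    apply sum_congr _ fun _ _ => rfl
    ext m
    simp only [mem_filter, Fintype.mem_piFinset, mem_Icc]
    constructor
    · rintro ⟨⟨h, hm⟩, hl⟩
      refine ⟨fun i => ⟨(h i).1, ?_⟩, hm⟩
      have := hm.monotone (Fin.le_last i)
      have := h (Fin.last d)
      omega
    · rintro ⟨h, hm⟩
      refine ⟨⟨fun i => ⟨(h i).1, by have := h i; omega⟩, hm⟩, ?_⟩
      have := h (Fin.last d)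
      omega
  · rw [zeta, mul_sum]
    refine sum_bij' (fun m _ => Fin.init m) (fun m _ => Fin.snoc m (M + 1)) ?_ ?_ ?_ ?_ ?_
    · intro m hm
      simp only [mem_filter, Fintype.mem_piFinset, mem_Icc] at hm ⊢
      refine ⟨fun i => ⟨(hm.1.1 _).1, ?_⟩, fun i j hij => hm.1.2 (by simpa using hij)⟩
      -- Strictness keeps the other variables at most `M`; in the star sum they may still equal `M +
      -- 1`.
      have := hm.1.2 (Fin.castSucc_lt_last i)
      simp only [Fin.init]
      omega
    · intro m hm
      simp only [mem_filter, Fintype.mem_piFinset, mem_Icc] at hm ⊢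
      refine ⟨⟨fun i => ?_, fun i j hij => ?_⟩, by simp⟩
      · induction i using Fin.lastCases with
        | last => simp
        | cast i =>
          have := hm.1 i
          simp only [Fin.snoc_castSucc]
          omega
      · induction j using Fin.lastCases with
        | last =>
          induction i using Fin.lastCases with
          | last => simp at hij
          | cast i =>
            have := hm.1 i
            simp only [Fin.snoc_castSucc, Fin.snoc_last]
            omega
        | cast j =>
          induction i using Fin.lastCases with
          | last => exact absurd hij (by simp [Fin.lt_def])
          | cast i => simpa using hm.2 (by simpa using hij)
    · intro m hm
      rw [mem_filter] at hm
      rw [← hm.2, Fin.snoc_init_self]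
    · intro m _
      simp
    · intro m hm
      rw [mem_filter] at hm
      rw [Fin.prod_univ_castSucc, hm.2, mul_comm]
      rfl

/-! ### Row and column sums indexed by contents. -/

/-- The weight `k ^ (-a_c)` of an entry `k` in a box of content `c`. -/
def weight (a : ℤ → ℂ) (k : ℕ) (c : ℤ) : ℂ := (k : ℂ) ^ (-(a c))

theorem one_div_cpow_eq_weight (a : ℤ → ℂ) (k : ℕ) (c : ℤ) :
    1 / (k : ℂ) ^ (a c) = weight a k c := by
  rw [weight, Complex.cpow_neg, one_div]

/-- The sum over the rows whose boxes have contents `m + 1, …, l`. -/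
def rowSum (a : ℤ → ℂ) (M : ℕ) (l m : ℤ) : ℂ := rowZetaStar M (l - m) (shift (m + 1) a)

/-- The sum over the columns whose boxes have contents `l, …, m + 1`. -/
def colSum (a : ℤ → ℂ) (M : ℕ) (l m : ℤ) : ℂ := colZeta M (l - m) (shift l a)

theorem rowSum_of_lt (a : ℤ → ℂ) (M : ℕ) {l m : ℤ} (h : l < m) : rowSum a M l m = 0 := by
  rw [rowSum, rowZetaStar, if_pos (by omega)]

theorem colSum_of_lt (a : ℤ → ℂ) (M : ℕ) {l m : ℤ} (h : l < m) : colSum a M l m = 0 := by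
  rw [colSum, colZeta, if_pos (by omega)]

theorem rowSum_add (a : ℤ → ℂ) (M : ℕ) (m : ℤ) (d : ℕ) :
    rowSum a M (m + d) m = zetaStar M fun i : Fin d => a (m + 1 + (i : ℕ)) := by
  rw [rowSum, rowZetaStar, if_neg (by omega)]
  have : (m + d - m).toNat = d := by omega
  rw [this]
  congr 1
  funext i
  rw [shift, add_comm]

theorem colSum_add (a : ℤ → ℂ) (M : ℕ) (m : ℤ) (d : ℕ) :
    colSum a M (m + d) m = zeta M fun i : Fin d => a (m + d - (i : ℕ)) := by
  rw [colSum, colZeta, if_neg (by omega)]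
  have : (m + d - m).toNat = d := by omega
  rw [this]
  congr 1
  funext i
  rw [shift]
  congr 1
  ring

theorem rowSum_self (a : ℤ → ℂ) (M : ℕ) (m : ℤ) : rowSum a M m m = 1 := by
  have := rowSum_add a M m 0
  rw [zetaStar_fin_zero] at this
  simpa using this

theorem colSum_self (a : ℤ → ℂ) (M : ℕ) (m : ℤ) : colSum a M m m = 1 := by
  have := colSum_add a M m 0
  rw [zeta_fin_zero] at this
  simpa using this

theorem rowSum_zero_of_ne (a : ℤ → ℂ) {l m : ℤ} (h : l ≠ m) : rowSum a 0 l m = 0 := by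
  rcases lt_or_gt_of_ne h with h | h
  · exact rowSum_of_lt a 0 h
  · obtain ⟨d, rfl⟩ : ∃ d : ℕ, l = m + (d + 1 : ℕ) := ⟨(l - m - 1).toNat, by omega⟩
    rw [rowSum_add, zetaStar_zero_succ]

theorem colSum_zero_of_ne (a : ℤ → ℂ) {l m : ℤ} (h : l ≠ m) : colSum a 0 l m = 0 := by
  rcases lt_or_gt_of_ne h with h | h
  · exact colSum_of_lt a 0 h
  · obtain ⟨d, rfl⟩ : ∃ d : ℕ, l = m + (d + 1 : ℕ) := ⟨(l - m - 1).toNat, by omega⟩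
    rw [colSum_add, zeta_zero_succ]

/-- The largest entry of a row is in its last box, of content `l`; the value `M + 1` may be repeated
to its left. -/
theorem rowSum_succ (a : ℤ → ℂ) (M : ℕ) (l m : ℤ) :
    rowSum a (M + 1) l m = rowSum a M l m + weight a (M + 1) l * rowSum a (M + 1) (l - 1) m := by
  rcases lt_trichotomy l m with h | rfl | h
  · rw [rowSum_of_lt a _ h, rowSum_of_lt a _ h, rowSum_of_lt a _ (by omega)]
    ring
  · rw [rowSum_self, rowSum_self, rowSum_of_lt a _ (by omega)]
    ring
  · obtain ⟨d, rfl⟩ : ∃ d : ℕ, l = m + (d + 1 : ℕ) := ⟨(l - m - 1).toNat, by omega⟩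
    have : m + (d + 1 : ℕ) - 1 = m + d := by push_cast; ring
    rw [this, rowSum_add, rowSum_add, rowSum_add, zetaStar_succ, one_div_cpow_eq_weight]
    congr 3
    simp
    ring

/-- The largest entry of a column is in its bottom box, of content `m + 1`, and `M + 1` occurs at
most once. -/
theorem colSum_succ (a : ℤ → ℂ) (M : ℕ) (l m : ℤ) :
    colSum a (M + 1) l m =
      colSum a M l m + colSum a M l (m + 1) * weight a (M + 1) (m + 1) := by
  rcases lt_trichotomy l m with h | rfl | h
  · rw [colSum_of_lt a _ h, colSum_of_lt a _ h, colSum_of_lt a _ (by omega)]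
    ring
  · rw [colSum_self, colSum_self, colSum_of_lt a _ (by omega)]
    ring
  · obtain ⟨d, rfl⟩ : ∃ d : ℕ, l = m + (d + 1 : ℕ) := ⟨(l - m - 1).toNat, by omega⟩
    have h1 := colSum_add a M (m + 1) d
    have : m + 1 + d = m + (d + 1 : ℕ) := by push_cast; ring
    rw [this] at h1
    rw [h1, colSum_add, colSum_add, zeta_succ, one_div_cpow_eq_weight, mul_comm]
    congr 3
    simp
    ring

/-! ### The branching rule for semistandard tableaux. -/

theorem mem_skewCells {lam mu : YoungDiagram} {c : ℕ × ℕ} :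
    c ∈ skewCells lam mu ↔ c ∈ lam ∧ c ∉ mu := by
  simp [skewCells]

theorem mem_ssyt {M : ℕ} {lam mu : YoungDiagram} {t : SkewTableau lam mu ℕ} :
    t ∈ ssyt M lam mu ↔ (∀ u, 1 ≤ t u ∧ t u ≤ M) ∧ IsSemistandard t := by
  simp [ssyt]

/-- The entries of a semistandard tableau increase weakly towards the lower right. -/
theorem IsSemistandard.le_of_le {lam mu : YoungDiagram} {t : SkewTableau lam mu ℕ}
    (ht : IsSemistandard t) (u v : skewCells lam mu) (h : u.1 ≤ v.1) : t u ≤ t v := by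
  obtain ⟨⟨i, j⟩, hu⟩ := u
  obtain ⟨⟨k, l⟩, hv⟩ := v
  obtain ⟨h1, h2⟩ : i ≤ k ∧ j ≤ l := h
  obtain ⟨p, rfl⟩ := Nat.exists_eq_add_of_le h1
  obtain ⟨q, rfl⟩ := Nat.exists_eq_add_of_le h2
  -- Skew shapes are convex: the whole rectangle between the two boxes belongs to the shape, so one
  -- can walk along the row and then down the column.
  have mem : ∀ p' ≤ p, ∀ q' ≤ q, (i + p', j + q') ∈ skewCells lam mu := by
    intro p' hp q' hq
    rw [mem_skewCells] at hu hv ⊢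
    exact ⟨lam.up_left_mem (by omega) (by omega) hv.1,
      fun h => hu.2 (mu.up_left_mem (by omega) (by omega) h)⟩
  have row : ∀ q' (hq : q' ≤ q), t ⟨(i, j), hu⟩ ≤ t ⟨(i + 0, j + q'), mem 0 (Nat.zero_le _) q' hq⟩ := by
    intro q'
    induction q' with
    | zero => exact fun _ => le_rfl
    | succ r ih => exact fun hq => (ih (by omega)).trans (ht.1 _ _ rfl)
  have col : ∀ p' (hp : p' ≤ p), t ⟨(i, j), hu⟩ ≤ t ⟨(i + p', j + q), mem p' hp q le_rfl⟩ := by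
    intro p'
    induction p' with
    | zero => exact fun _ => row q le_rfl
    | succ r ih => exact fun hq => (ih (by omega)).trans (ht.2 _ _ rfl).le
  exact col p le_rfl

/-- The diagram `nu` is contained in `lam` and `lam / nu` is a horizontal strip. -/
def IsStrip (lam nu : YoungDiagram) : Prop :=
  nu ≤ lam ∧ ∀ i j, (i + 1, j) ∈ lam → (i, j) ∈ nu

theorem finite_setOf_le (lam : YoungDiagram) : {nu : YoungDiagram | nu ≤ lam}.Finite := by
  refine Set.Finite.of_finite_image (f := YoungDiagram.cells) ?_ fun _ _ _ _ h =>
    YoungDiagram.ext h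
  refine (lam.cells.powerset.finite_toSet).subset ?_
  rintro _ ⟨nu, h, rfl⟩
  simpa using h

theorem finite_strips (lam mu : YoungDiagram) :
    {nu : YoungDiagram | mu ≤ nu ∧ IsStrip lam nu}.Finite :=
  (finite_setOf_le lam).subset fun _ h => h.2.1

/-- The diagrams `nu ⊇ mu` such that `lam / nu` is a horizontal strip. -/
def strips (lam mu : YoungDiagram) : Finset YoungDiagram := (finite_strips lam mu).toFinset

theorem mem_strips {lam mu nu : YoungDiagram} :
    nu ∈ strips lam mu ↔ mu ≤ nu ∧ IsStrip lam nu := by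
  simp [strips]

/-- The diagram formed by `mu` and the boxes with entry at most `M`. -/
theorem exists_lowerDiagram {M : ℕ} {lam mu : YoungDiagram} (hmu : mu ≤ lam)
    {t : SkewTableau lam mu ℕ} (ht : t ∈ ssyt (M + 1) lam mu) :
    ∃ nu ∈ strips lam mu, ∀ u, t u ≤ M ↔ u.1 ∈ nu := by
  classical
  rw [mem_ssyt] at ht
  let nu : YoungDiagram :=
    { cells := lam.cells.filter fun c => c ∈ mu ∨ ∃ h : c ∈ skewCells lam mu, t ⟨c, h⟩ ≤ M
      isLowerSet := by
        intro c d hdc hc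
        simp only [coe_filter, Set.mem_ofPred_eq, YoungDiagram.mem_cells] at hc ⊢
        refine ⟨lam.isLowerSet hdc hc.1, ?_⟩
        by_cases hd : d ∈ mu
        · exact Or.inl hd
        · rcases hc.2 with h | ⟨h, hle⟩
          · exact absurd (mu.isLowerSet hdc h) hd
          · have hd' : d ∈ skewCells lam mu := mem_skewCells.2 ⟨lam.isLowerSet hdc hc.1, hd⟩
            exact Or.inr ⟨hd', (ht.2.le_of_le ⟨d, hd'⟩ ⟨c, h⟩ hdc).trans hle⟩ }
  have hnu : ∀ c, c ∈ nu ↔ c ∈ lam ∧ (c ∈ mu ∨ ∃ h : c ∈ skewCells lam mu, t ⟨c, h⟩ ≤ M) := by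
    intro c
    rw [← YoungDiagram.mem_cells]
    simp only [nu, mem_filter, YoungDiagram.mem_cells]
  refine ⟨nu, mem_strips.2 ⟨fun c hc => (hnu c).2 ⟨hmu hc, Or.inl hc⟩,
    fun c hc => ((hnu c).1 hc).1, fun i j hij => ?_⟩, fun u => ?_⟩
  · have hlam : (i, j) ∈ lam := lam.up_left_mem (Nat.le_succ i) le_rfl hij
    refine (hnu _).2 ⟨hlam, ?_⟩
    by_cases hm : (i, j) ∈ mu
    · exact Or.inl hm
    · have h1 : (i, j) ∈ skewCells lam mu := mem_skewCells.2 ⟨hlam, hm⟩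
      have h2 : (i + 1, j) ∈ skewCells lam mu :=
        mem_skewCells.2 ⟨hij, fun h => hm (mu.up_left_mem (Nat.le_succ i) le_rfl h)⟩
      have := ht.2.2 ⟨_, h1⟩ ⟨_, h2⟩ rfl
      have := ht.1 ⟨_, h2⟩
      exact Or.inr ⟨h1, by omega⟩
  · have hu := mem_skewCells.1 u.2
    rw [hnu]
    constructor
    · exact fun h => ⟨hu.1, Or.inr ⟨u.2, h⟩⟩
    · rintro ⟨-, h | ⟨_, h⟩⟩
      · exact absurd h hu.2
      · exact h

theorem skewCells_mono {lam mu nu : YoungDiagram} (h : nu ≤ lam) {c : ℕ × ℕ}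
    (hc : c ∈ skewCells nu mu) : c ∈ skewCells lam mu := by
  rw [mem_skewCells] at hc ⊢
  exact ⟨h hc.1, hc.2⟩

open Classical in
/-- The contribution of the tableaux whose boxes with entry at most `M` form `nu / mu`. -/
theorem sum_ssyt_filter (a : ℤ → ℂ) (M : ℕ) {lam mu nu : YoungDiagram} (hmu : mu ≤ nu)
    (hs : IsStrip lam nu) :
    ∑ t ∈ (ssyt (M + 1) lam mu).filter (fun t => ∀ u, t u ≤ M ↔ u.1 ∈ nu),
        ∏ u, weight a (t u) (content u.1) =
      (∏ c ∈ lam.cells \ nu.cells, weight a (M + 1) (content c)) * diagZeta M nu mu a := by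
  have hmem : ∀ u : skewCells lam mu, u.1 ∈ nu → u.1 ∈ skewCells nu mu := fun u h =>
    mem_skewCells.2 ⟨h, (mem_skewCells.1 u.2).2⟩
  rw [diagZeta, schurZeta, mul_sum]
  -- Restriction to `nu / mu` is inverted by filling the remaining boxes with `M + 1`.
  refine sum_bij' (fun t _ u => t ⟨u.1, skewCells_mono hs.1 u.2⟩)
    (fun t _ u => if h : u.1 ∈ nu then t ⟨u.1, hmem u h⟩ else M + 1) ?_ ?_ ?_ ?_ ?_
  · intro t ht
    rw [mem_filter, mem_ssyt] at ht
    rw [mem_ssyt]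
    exact ⟨fun u => ⟨(ht.1.1 _).1, (ht.2 _).2 (mem_skewCells.1 u.2).1⟩,
      fun u v h => ht.1.2.1 _ _ h, fun u v h => ht.1.2.2 _ _ h⟩
  · intro t ht
    rw [mem_ssyt] at ht
    rw [mem_filter, mem_ssyt]
    refine ⟨⟨fun u => ?_, fun u v h => ?_, fun u v h => ?_⟩, fun u => ?_⟩
    · split_ifs with h
      · have := ht.1 ⟨u.1, hmem u h⟩
        omega
      · omega
    · dsimp only
      by_cases hv : v.1 ∈ nu
      · have hu : u.1 ∈ nu := by
          rw [h] at hv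
          exact nu.up_left_mem le_rfl (Nat.le_succ _) hv
        rw [dif_pos hu, dif_pos hv]
        exact ht.2.1 _ _ h
      · rw [dif_neg hv]
        split_ifs with hu
        · have := ht.1 ⟨u.1, hmem u hu⟩
          omega
        · rfl
    -- The strip condition puts the upper of two vertically adjacent boxes in `nu`, so `M + 1` never
    -- repeats in a column.
    · have hu : u.1 ∈ nu := by
        have := (mem_skewCells.1 v.2).1
        rw [h] at this
        exact hs.2 _ _ this
      dsimp only
      rw [dif_pos hu]
      split_ifs with hv
      · exact ht.2.2 _ _ h
      · have := ht.1 ⟨u.1, hmem u hu⟩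
        omega
    · dsimp only
      split_ifs with h
      · exact iff_of_true (ht.1 _).2 h
      · exact iff_of_false (by omega) h
  · intro t ht
    rw [mem_filter, mem_ssyt] at ht
    funext u
    dsimp only
    split_ifs with h
    · rfl
    · have := (ht.2 u).not.2 h
      have := ht.1.1 u
      omega
  · intro t ht
    funext u
    dsimp only
    rw [dif_pos (mem_skewCells.1 u.2).1]
  · intro t ht
    rw [mem_filter, mem_ssyt] at ht
    let T : ℕ × ℕ → ℕ := fun c => if h : c ∈ skewCells lam mu then t ⟨c, h⟩ else 0
    have hT : ∀ c (h : c ∈ skewCells lam mu), t ⟨c, h⟩ = T c := fun c h => by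
      simp only [T, dif_pos h]
    have e1 : ∏ u, weight a (t u) (content u.1) =
        ∏ c ∈ skewCells lam mu, weight a (T c) (content c) := by
      rw [← prod_coe_sort (skewCells lam mu) fun c => weight a (T c) (content c)]
      exact prod_congr rfl fun u _ => by rw [← hT u.1 u.2]
    have e2 : ∏ u : skewCells nu mu,
          ((t ⟨u.1, skewCells_mono hs.1 u.2⟩ : ℕ) : ℂ) ^ (-(diagIndex a nu mu u)) =
        ∏ c ∈ skewCells nu mu, weight a (T c) (content c) := by
      rw [← prod_coe_sort (skewCells nu mu) fun c => weight a (T c) (content c)]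
      exact prod_congr rfl fun u _ => by rw [← hT u.1 (skewCells_mono hs.1 u.2)]; rfl
    have hU : skewCells lam mu = (lam.cells \ nu.cells) ∪ skewCells nu mu := by
      ext c
      simp only [mem_union, mem_sdiff, YoungDiagram.mem_cells]
      constructor
      · rintro ⟨h1, h2⟩
        by_cases h : c ∈ nu
        · exact Or.inr ⟨h, h2⟩
        · exact Or.inl ⟨h1, h⟩
      · rintro (⟨h1, h2⟩ | ⟨h1, h2⟩)
        · exact ⟨h1, fun h => h2 (hmu h)⟩
        · exact ⟨hs.1 h1, h2⟩
    rw [e1, e2, hU, prod_union]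
    · congr 1
      refine prod_congr rfl fun c hc => ?_
      rw [mem_sdiff, YoungDiagram.mem_cells, YoungDiagram.mem_cells] at hc
      have hc' : c ∈ skewCells lam mu := mem_skewCells.2 ⟨hc.1, fun h => hc.2 (hmu h)⟩
      have h1 := ht.1.1 ⟨c, hc'⟩
      have h2 := (ht.2 ⟨c, hc'⟩).not.2 hc.2
      rw [hT] at h1 h2
      have : T c = M + 1 := by omega
      rw [this]
    · rw [disjoint_left]
      intro c hc hc'
      rw [mem_sdiff] at hc
      exact hc.2 (mem_skewCells.1 hc').1

/-- Branching rule: removing the boxes with entry `M + 1`. -/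
theorem diagZeta_succ (a : ℤ → ℂ) (M : ℕ) {lam mu : YoungDiagram} (hmu : mu ≤ lam) :
    diagZeta (M + 1) lam mu a = ∑ nu ∈ strips lam mu,
      (∏ c ∈ lam.cells \ nu.cells, weight a (M + 1) (content c)) * diagZeta M nu mu a := by
  classical
  have hU : ssyt (M + 1) lam mu = (strips lam mu).biUnion fun nu =>
      (ssyt (M + 1) lam mu).filter fun t => ∀ u, t u ≤ M ↔ u.1 ∈ nu := by
    ext t
    simp only [mem_biUnion, mem_filter]
    constructor
    · intro ht
      obtain ⟨nu, h1, h2⟩ := exists_lowerDiagram hmu ht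
      exact ⟨nu, h1, ht, h2⟩
    · rintro ⟨nu, -, ht, -⟩
      exact ht
  have hsum : diagZeta (M + 1) lam mu a =
      ∑ t ∈ ssyt (M + 1) lam mu, ∏ u, weight a (t u) (content u.1) := rfl
  rw [hsum, hU, sum_biUnion]
  · refine sum_congr rfl fun nu hnu => ?_
    rw [mem_strips] at hnu
    exact sum_ssyt_filter a M hnu.1 hnu.2
  · intro nu hnu nu' hnu' hne
    rw [Function.onFun, disjoint_left]
    intro t ht ht'
    rw [mem_coe, mem_strips] at hnu hnu'
    rw [mem_filter] at ht ht'
    refine hne (SetLike.ext fun c => ?_)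
    by_cases hc : c ∈ mu
    · exact iff_of_true (hnu.1 hc) (hnu'.1 hc)
    · by_cases hl : c ∈ lam
      · exact (ht.2 ⟨c, mem_skewCells.2 ⟨hl, hc⟩⟩).symm.trans (ht'.2 _)
      · exact iff_of_false (fun h => hl (hnu.2.1 h)) (fun h => hl (hnu'.2.1 h))

theorem diagZeta_self (a : ℤ → ℂ) (M : ℕ) (lam : YoungDiagram) : diagZeta M lam lam a = 1 := by
  have : IsEmpty (skewCells lam lam) := ⟨fun u => by
    have := mem_skewCells.1 u.2
    exact this.2 this.1⟩
  have hs : ssyt M lam lam = univ := by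
    ext t
    rw [mem_ssyt]
    exact iff_of_true ⟨fun u => this.elim u, fun u => this.elim u, fun u => this.elim u⟩
      (mem_univ t)
  rw [diagZeta, schurZeta, hs, Fintype.sum_unique, Fintype.prod_empty]

theorem diagZeta_zero_of_not_le (a : ℤ → ℂ) {lam mu : YoungDiagram} (h : ¬ lam ≤ mu) :
    diagZeta 0 lam mu a = 0 := by
  obtain ⟨c, hc, hc'⟩ : ∃ c ∈ lam, c ∉ mu := by
    by_contra! hcon
    exact h fun c hc => hcon c hc
  rw [diagZeta, schurZeta]
  refine sum_eq_zero fun t ht => ?_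
  have := (mem_ssyt.1 ht).1 ⟨c, mem_skewCells.2 ⟨hc, hc'⟩⟩
  omega

/-! ### Bidiagonal row operations and determinants of row sums. -/

/-- The upper bidiagonal matrix with diagonal entries `1` and entries `-c i` above them. -/
def bidiag (n : ℕ) (c : ℕ → ℂ) : Matrix (Fin n) (Fin n) ℂ :=
  Matrix.of fun i j => if j = i then 1 else if (j : ℕ) = i + 1 then -c i else 0

theorem det_bidiag (n : ℕ) (c : ℕ → ℂ) : (bidiag n c).det = 1 := by
  rw [Matrix.det_of_isUpperTriangular]
  · simp [bidiag]
  · intro i j hij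
    have h : (j : ℕ) < i := hij
    rw [bidiag, Matrix.of_apply, if_neg (by omega), if_neg (by omega)]

/-- The condition on `f n` lets the last row follow the same rule as the others. -/
theorem bidiag_mul_apply {n : ℕ} (c : ℕ → ℂ) (f : ℕ → Fin n → ℂ) (hf : ∀ j, f n j = 0)
    (i j : Fin n) :
    (bidiag n c * Matrix.of fun i : Fin n => f i) i j = f i j - c i * f (i + 1) j := by
  have h : ∀ k : Fin n, bidiag n c i k * f k j =
      (if k = i then f i j else 0) + if (k : ℕ) = i + 1 then -(c i * f (i + 1) j) else 0 := by
    intro k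
    rw [bidiag, Matrix.of_apply]
    by_cases h1 : k = i
    · subst h1
      simp
    · by_cases h2 : (k : ℕ) = i + 1
      · simp [h1, h2]
      · simp [h1, h2]
  simp only [Matrix.mul_apply, Matrix.of_apply, h]
  rw [sum_add_distrib, sum_ite_eq' univ i, if_pos (mem_univ _), sub_eq_add_neg]
  congr 1
  by_cases hi : (i : ℕ) + 1 < n
  · rw [sum_eq_single (⟨i + 1, hi⟩ : Fin n)]
    · simp
    · intro k _ hk
      rw [if_neg fun h => hk (Fin.ext h)]
    · simp
  · have : (i : ℕ) + 1 = n := by omega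
    rw [this, hf, mul_zero, neg_zero]
    exact sum_eq_zero fun k _ => by rw [if_neg (by omega)]

/-- Columns are numbered from `1` in `g`, leaving `g i 0 = 0` as a virtual column before the first;
it also makes the truncated `c (j - 1)` at `j = 0` harmless. -/
theorem mul_bidiag_apply {n : ℕ} (c : ℕ → ℂ) (g : Fin n → ℕ → ℂ) (hg : ∀ i, g i 0 = 0)
    (i j : Fin n) :
    ((Matrix.of fun i j : Fin n => g i (j + 1)) * bidiag n c) i j =
      g i (j + 1) - g i j * c (j - 1) := by
  have h : ∀ k : Fin n, g i (k + 1) * bidiag n c k j =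
      (if k = j then g i (j + 1) else 0) + if (j : ℕ) = k + 1 then -(g i j * c (j - 1)) else 0 := by
    intro k
    rw [bidiag, Matrix.of_apply]
    by_cases h1 : k = j
    · subst h1
      simp
    · by_cases h2 : (j : ℕ) = k + 1
      · simp [Ne.symm h1, h1, h2]
      · simp [h1, Ne.symm h1, h2]
  simp only [Matrix.mul_apply, Matrix.of_apply, h]
  rw [sum_add_distrib, sum_ite_eq' univ j, if_pos (mem_univ _), sub_eq_add_neg]
  congr 1
  by_cases hj : 0 < (j : ℕ)
  · rw [sum_eq_single (⟨j - 1, by omega⟩ : Fin n)]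
    · rw [if_pos]
      exact (Nat.succ_pred_eq_of_pos hj).symm
    · intro k _ hk
      rw [if_neg fun h => hk (Fin.ext (by simp [h]))]
    · simp
  · have : (j : ℕ) = 0 := by omega
    rw [this, hg, zero_mul, neg_zero]
    exact sum_eq_zero fun k _ => by rw [if_neg (by omega)]

/-- Iterating `rowSum_succ` from `l` down to `k` telescopes; `r` marks where the final run of
entries `M + 1` begins. -/
theorem rowSum_sub (a : ℤ → ℂ) (M : ℕ) (m : ℤ) {k l : ℤ} (h : k ≤ l) :
    rowSum a (M + 1) l m - (∏ c ∈ Ioc k l, weight a (M + 1) c) * rowSum a (M + 1) k m =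
      ∑ r ∈ Ioc k l, (∏ c ∈ Ioc r l, weight a (M + 1) c) * rowSum a M r m := by
  induction l, h using Int.leInduction with
  | base => simp
  | succ l hl ih =>
    have hI : ∀ r ≤ l, Ioc r (l + 1) = insert (l + 1) (Ioc r l) := by
      intro r hr
      ext x
      simp only [mem_Ioc, mem_insert]
      omega
    have hp : ∀ r ≤ l, ∏ c ∈ Ioc r (l + 1), weight a (M + 1) c =
        weight a (M + 1) (l + 1) * ∏ c ∈ Ioc r l, weight a (M + 1) c := by
      intro r hr
      rw [hI r hr, prod_insert (by simp)]
    rw [hp k hl, hI k hl, sum_insert (by simp), rowSum_succ, add_sub_cancel_right]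
    have : ∑ r ∈ Ioc k l, (∏ c ∈ Ioc r (l + 1), weight a (M + 1) c) * rowSum a M r m =
        weight a (M + 1) (l + 1) *
          ∑ r ∈ Ioc k l, (∏ c ∈ Ioc r l, weight a (M + 1) c) * rowSum a M r m := by
      rw [mul_sum]
      refine sum_congr rfl fun r hr => ?_
      rw [hp r (mem_Ioc.1 hr).2, mul_assoc]
    rw [this, ← ih]
    simp
    ring

/-- Expansion of a determinant of row sums along the entries equal to `M + 1`. -/
theorem det_rowSum_succ (a : ℤ → ℂ) (M : ℕ) {n : ℕ} (L : ℕ → ℤ) (hL : Antitone L)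
    (m : Fin n → ℤ) (hm : ∀ j, L n < m j) :
    (Matrix.of fun i j : Fin n => rowSum a (M + 1) (L i) (m j)).det =
      ∑ f ∈ Fintype.piFinset fun i : Fin n => Ioc (L (i + 1)) (L i),
        (∏ i, ∏ c ∈ Ioc (f i) (L i), weight a (M + 1) c) *
          (Matrix.of fun i j : Fin n => rowSum a M (f i) (m j)).det := by
  set A := Matrix.of fun i j : Fin n => rowSum a (M + 1) (L i) (m j) with hA
  let c : ℕ → ℂ := fun i => ∏ c ∈ Ioc (L (i + 1)) (L i), weight a (M + 1) c
  have h1 : A.det = (bidiag n c * A).det := by rw [Matrix.det_mul, det_bidiag, one_mul]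
  -- Each row minus a multiple of the next becomes a sum of rows for `M`; multilinearity then
  -- expands the determinant.
  have h2 : bidiag n c * A = fun i : Fin n => ∑ r ∈ Ioc (L (i + 1)) (L i),
      (∏ c ∈ Ioc r (L i), weight a (M + 1) c) • fun j : Fin n => rowSum a M r (m j) := by
    ext i j
    have := bidiag_mul_apply c (fun (i : ℕ) (j : Fin n) => rowSum a (M + 1) (L i) (m j))
      (fun j => rowSum_of_lt a _ (hm j)) i j
    rw [Finset.sum_apply]
    exact this.trans (rowSum_sub a M (m j) (hL (Nat.le_succ i)))
  rw [h1, h2]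
  refine (Matrix.detRowAlternating.toMultilinearMap.map_sum_finset _ _).trans ?_
  refine sum_congr rfl fun f _ => ?_
  exact Matrix.detRowAlternating.toMultilinearMap.map_smul_univ _ _

theorem det_eq_zero_of_lower_left {n : ℕ} (A : Matrix (Fin n) (Fin n) ℂ) (i : Fin n)
    (h : ∀ r c, i ≤ r → c ≤ i → A r c = 0) : A.det = 0 := by
  rw [Matrix.det_apply]
  refine sum_eq_zero fun σ _ => ?_
  -- Pigeonhole: the `i + 1` columns up to `i` cannot inject into the `i` rows before `i`, so every
  -- term meets the zero block.
  obtain ⟨c, hc, hr⟩ : ∃ c ≤ i, i ≤ σ c := by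
    by_contra! hcon
    have := card_le_card_of_injOn (s := Iic i) (t := Iio i) σ
      (fun c hc => by simpa using hcon c (by simpa using hc)) σ.injective.injOn
    simp at this
  have h0 : ∏ j, A (σ j) j = 0 := prod_eq_zero (mem_univ c) (h _ _ hr hc)
  rw [h0, smul_zero]

/-! ### Row ends, horizontal strips and the Jacobi–Trudi formula. -/

/-- The content of the last box of a row (numbered from `0`), or of the box left of the row. -/
def pos (lam : YoungDiagram) (i : ℕ) : ℤ := lam.rowLen i - i - 1

theorem pos_strictAnti (lam : YoungDiagram) : StrictAnti (pos lam) := by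
  intro i j hij
  have := lam.rowLen_anti i j hij.le
  simp only [pos]
  omega

theorem mem_iff_lt_pos {lam : YoungDiagram} {i j : ℕ} :
    (i, j) ∈ lam ↔ (j : ℤ) - i ≤ pos lam i := by
  rw [YoungDiagram.mem_iff_lt_rowLen, pos]
  omega

theorem le_of_forall_pos_le {n : ℕ} {lam mu : YoungDiagram} (hn : mu.rowLen n = 0)
    (h : ∀ i : Fin n, pos mu i ≤ pos lam i) : mu ≤ lam := by
  rintro ⟨i, j⟩ hij
  by_cases hi : i < n
  · have := h ⟨i, hi⟩
    rw [mem_iff_lt_pos] at hij ⊢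
    exact hij.trans this
  · have := mu.rowLen_anti n i (by omega)
    rw [YoungDiagram.mem_iff_lt_rowLen] at hij
    omega

theorem rowLen_mono {lam mu : YoungDiagram} (h : mu ≤ lam) (i : ℕ) :
    mu.rowLen i ≤ lam.rowLen i := by
  by_contra! hlt
  have h1 : (i, lam.rowLen i) ∈ lam := h (YoungDiagram.mem_iff_lt_rowLen.2 hlt)
  exact absurd (YoungDiagram.mem_iff_lt_rowLen.1 h1) (lt_irrefl _)

theorem pos_mono {lam mu : YoungDiagram} (h : mu ≤ lam) (i : ℕ) : pos mu i ≤ pos lam i := by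
  have := rowLen_mono h i
  simp only [pos]
  omega

theorem IsStrip.pos_lt {lam nu : YoungDiagram} (h : IsStrip lam nu) (i : ℕ) :
    pos lam (i + 1) < pos nu i := by
  have : lam.rowLen (i + 1) ≤ nu.rowLen i := by
    by_contra! hlt
    have h1 := h.2 i _ (YoungDiagram.mem_iff_lt_rowLen.2 hlt)
    exact absurd (YoungDiagram.mem_iff_lt_rowLen.1 h1) (lt_irrefl _)
  simp only [pos]
  omega

/-- Row `i` of `lam / nu` has exactly the contents in `Ioc (pos nu i) (pos lam i)`. -/
theorem prod_sdiff_content {n : ℕ} {lam nu : YoungDiagram} (hn : lam.rowLen n = 0) (w : ℤ → ℂ) :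
    ∏ c ∈ lam.cells \ nu.cells, w (content c) =
      ∏ i : Fin n, ∏ c ∈ Ioc (pos nu i) (pos lam i), w c := by
  have hlt : ∀ c ∈ lam.cells \ nu.cells, c.1 < n := by
    rintro ⟨i, j⟩ hc
    by_contra! hi
    have := lam.rowLen_anti n i hi
    rw [mem_sdiff, YoungDiagram.mem_cells, YoungDiagram.mem_iff_lt_rowLen] at hc
    omega
  rw [prod_sigma']
  refine prod_bij' (fun c hc => ⟨⟨c.1, hlt c hc⟩, content c⟩)
    (fun s _ => (s.1, (s.2 + s.1).toNat)) ?_ ?_ ?_ ?_ ?_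
  · rintro ⟨i, j⟩ hc
    rw [mem_sdiff, YoungDiagram.mem_cells, YoungDiagram.mem_cells, mem_iff_lt_pos,
      mem_iff_lt_pos] at hc
    simp only [mem_sigma, mem_univ, true_and, mem_Ioc, content]
    omega
  · rintro ⟨i, c⟩ hc
    simp only [mem_sigma, mem_univ, true_and, mem_Ioc] at hc
    rw [mem_sdiff, YoungDiagram.mem_cells, YoungDiagram.mem_cells, mem_iff_lt_pos,
      mem_iff_lt_pos]
    have : -(i : ℤ) - 1 ≤ pos nu i := by
      simp only [pos]
      omega
    dsimp only
    omega
  · rintro ⟨i, j⟩ hc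
    simp [content]
  · rintro ⟨i, c⟩ hc
    simp only [mem_sigma, mem_univ, true_and, mem_Ioc] at hc
    have : -(i : ℤ) - 1 ≤ pos nu i := by
      simp only [pos]
      omega
    simp only [content, Sigma.mk.injEq, Fin.eta, heq_eq_eq, true_and]
    omega
  · rintro ⟨i, j⟩ hc
    rfl

/-- Interlacing characterises horizontal strips: this is the converse to `IsStrip.pos_lt` and
`pos_mono`. -/
theorem exists_pos_eq {n : ℕ} {lam : YoungDiagram} (f : Fin n → ℤ)
    (hf : ∀ i : Fin n, pos lam (i + 1) < f i ∧ f i ≤ pos lam i) :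
    ∃ nu, IsStrip lam nu ∧ ∀ i : Fin n, pos nu i = f i := by
  let g : ℕ → ℤ := fun i => if h : i < n then f ⟨i, h⟩ else pos lam i
  have hg : ∀ i, pos lam (i + 1) < g i ∧ g i ≤ pos lam i := by
    intro i
    by_cases h : i < n
    · simp only [g, dif_pos h]
      exact hf ⟨i, h⟩
    · simp only [g, dif_neg h]
      exact ⟨pos_strictAnti lam (Nat.lt_succ_self i), le_rfl⟩
  -- Up to the constant `1`, `g i + i` is the new row length, so this makes the row lengths weakly
  -- decreasing.
  have hg' : ∀ i j, i ≤ j → g j + j ≤ g i + i := by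
    intro i j hij
    induction j, hij using Nat.le_induction with
    | base => rfl
    | succ j _ ih =>
      have h1 := hg j
      have h2 := hg (j + 1)
      push_cast
      omega
  let S : Finset (ℕ × ℕ) := lam.cells.filter fun c => content c ≤ g c.1
  have hS : ∀ i j, (i, j) ∈ S ↔ (i, j) ∈ lam ∧ (j : ℤ) - i ≤ g i := by
    intro i j
    rw [mem_filter, YoungDiagram.mem_cells]
    rfl
  let nu : YoungDiagram :=
    { cells := S
      isLowerSet := by
        rintro ⟨i, j⟩ ⟨i', j'⟩ h hc
        obtain ⟨h1, h2⟩ : i' ≤ i ∧ j' ≤ j := h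
        rw [mem_coe, hS] at hc ⊢
        refine ⟨lam.up_left_mem h1 h2 hc.1, ?_⟩
        have := hg' i' i h1
        omega }
  have hnu : ∀ i j, (i, j) ∈ nu ↔ (j : ℤ) - i ≤ g i := by
    intro i j
    refine (hS i j).trans ?_
    rw [mem_iff_lt_pos]
    have := hg i
    omega
  refine ⟨nu, ⟨fun c hc => ?_, fun i j hij => ?_⟩, fun i => ?_⟩
  · exact ((hS c.1 c.2).1 hc).1
  · rw [hnu]
    rw [mem_iff_lt_pos] at hij
    have := hg i
    push_cast at hij
    omega
  · have hi : g i = f i := by simp only [g, dif_pos i.2]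
    rw [← hi]
    have h0 : -(i : ℤ) - 1 ≤ g i := by
      have := hg i
      simp only [pos] at this
      push_cast at this
      omega
    have h1 := hnu i (nu.rowLen i)
    rw [YoungDiagram.mem_iff_lt_rowLen] at h1
    have h2 := hnu i (nu.rowLen i - 1)
    rw [YoungDiagram.mem_iff_lt_rowLen] at h2
    simp only [pos]
    omega

/-- Jacobi–Trudi formula. -/
theorem diagZeta_eq_det (a : ℤ → ℂ) {n : ℕ} (M : ℕ) {lam mu : YoungDiagram} (hmu : mu ≤ lam)
    (hn : lam.rowLen n = 0) :
    diagZeta M lam mu a =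
      (Matrix.of fun i j : Fin n => rowSum a M (pos lam i) (pos mu j)).det := by
  classical
  induction M generalizing lam with
  | zero =>
    by_cases h : lam ≤ mu
    · obtain rfl := le_antisymm h hmu
      have : (Matrix.of fun i j : Fin n => rowSum a 0 (pos lam i) (pos lam j)) = 1 := by
        ext i j
        rw [Matrix.of_apply, Matrix.one_apply]
        split_ifs with hij
        · rw [hij, rowSum_self]
        · exact rowSum_zero_of_ne a fun h =>
            hij (Fin.ext ((pos_strictAnti lam).injective h))
      rw [diagZeta_self, this, Matrix.det_one]
    · obtain ⟨i, hi⟩ : ∃ i : Fin n, pos mu i < pos lam i := by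
        by_contra! hcon
        exact h (le_of_forall_pos_le hn hcon)
      -- For `M = 0` only empty rows contribute, and the resulting zero block is at the upper right,
      -- hence the transpose.
      rw [diagZeta_zero_of_not_le a h, ← Matrix.det_transpose, det_eq_zero_of_lower_left _ i]
      intro r c hr hc
      rw [Matrix.transpose_apply, Matrix.of_apply]
      refine rowSum_zero_of_ne a (ne_of_gt ?_)
      exact ((pos_strictAnti mu).antitone hr).trans_lt
        (hi.trans_le ((pos_strictAnti lam).antitone hc))
  | succ M ih =>
    rw [diagZeta_succ a M hmu, det_rowSum_succ a M (pos lam) (pos_strictAnti lam).antitone]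
    · have hinj : Set.InjOn (fun (nu : YoungDiagram) (i : Fin n) => pos nu i)
          (strips lam mu) := by
        intro nu hnu nu' hnu' heq
        rw [mem_coe, mem_strips] at hnu hnu'
        have h0 := rowLen_mono hnu.2.1 n
        have h0' := rowLen_mono hnu'.2.1 n
        exact le_antisymm
          (le_of_forall_pos_le (n := n) (by omega) fun i => (congrFun heq i).le)
          (le_of_forall_pos_le (n := n) (by omega) fun i => (congrFun heq i).ge)
      have hsub : (strips lam mu).image (fun (nu : YoungDiagram) (i : Fin n) => pos nu i) ⊆
          Fintype.piFinset fun i : Fin n => Ioc (pos lam (i + 1)) (pos lam i) := by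
        intro f hf
        obtain ⟨nu, hnu, rfl⟩ := mem_image.1 hf
        rw [mem_strips] at hnu
        exact Fintype.mem_piFinset.2 fun i => mem_Ioc.2 ⟨hnu.2.pos_lt i, pos_mono hnu.2.1 i⟩
      rw [← sum_subset hsub, sum_image hinj]
      · refine sum_congr rfl fun nu hnu => ?_
        rw [mem_strips] at hnu
        have h0 := rowLen_mono hnu.2.1 n
        rw [prod_sdiff_content hn, ih hnu.1 (by omega)]
      · intro f hf hf'
        rw [Fintype.mem_piFinset] at hf
        obtain ⟨nu, hnu, hpos⟩ := exists_pos_eq f fun i => mem_Ioc.1 (hf i)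
        -- The expansion also contains strips whose `nu` fails to contain `mu`; a row of `nu`
        -- shorter than that of `mu` kills their determinant.
        obtain ⟨i, hi⟩ : ∃ i : Fin n, pos nu i < pos mu i := by
          by_contra! hcon
          refine hf' (mem_image.2 ⟨nu, mem_strips.2 ⟨?_, hnu⟩, funext hpos⟩)
          have := rowLen_mono hmu n
          exact le_of_forall_pos_le (n := n) (by omega) hcon
        rw [det_eq_zero_of_lower_left _ i, mul_zero]
        intro r c hr hc
        rw [Matrix.of_apply, ← hpos]
        refine rowSum_of_lt a _ ?_
        exact ((pos_strictAnti nu).antitone hr).trans_lt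
          (hi.trans_le ((pos_strictAnti mu).antitone hc))
    -- Row `n` of `lam` is empty, so its end `-n - 1` lies to the left of every `pos mu j` with `j <
    -- n`.
    · intro j
      have := j.2
      simp only [pos]
      omega

/-! ### Determinants after replacing rows and columns. -/

theorem mul_one_submatrix {N P R : Type*} [Fintype N] [DecidableEq N] (A : Matrix R N ℂ)
    (s : P → N) : A * (1 : Matrix N N ℂ).submatrix id s = A.submatrix id s := by
  ext i j
  simp [Matrix.mul_apply, Matrix.one_apply]

theorem one_submatrix_mul {N Q R : Type*} [Fintype N] [DecidableEq N] (A : Matrix N R ℂ)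
    (d : Q → N) : (1 : Matrix N N ℂ).submatrix d id * A = A.submatrix d id := by
  ext i j
  simp [Matrix.mul_apply, Matrix.one_apply]

/-- The determinant of a matrix `Y` arising from `B` by replacing the rows `s i` and the
columns `d j`, in terms of the inverse `F` of `B`. -/
theorem det_replace_rows_cols {N P Q : Type*} [Fintype N] [DecidableEq N] [Fintype P]
    [DecidableEq P] [Fintype Q] [DecidableEq Q] {B F Y : Matrix N N ℂ} (hFB : F * B = 1)
    (hB : B.det = 1) {s : P → N} (hs : s.Injective) {d : Q → N} (hd : d.Injective)
    (X : Matrix P N ℂ) (Z : Matrix P Q ℂ) (h11 : ∀ i j, Y (s i) (d j) = Z i j)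
    (h12 : ∀ i c, (∀ j, c ≠ d j) → Y (s i) c = X i c)
    (h21 : ∀ r j, (∀ i, r ≠ s i) → Y r (d j) = 0)
    (h22 : ∀ r c, (∀ i, r ≠ s i) → (∀ j, c ≠ d j) → Y r c = B r c) :
    Y.det = (-1) ^ Fintype.card Q *
      (Matrix.fromBlocks ((X * F).submatrix id s) Z (F.submatrix d s) 0).det := by
  have hBF : B * F = 1 := mul_eq_one_comm.1 hFB
  let S : Matrix N P ℂ := (1 : Matrix N N ℂ).submatrix id s
  let D : Matrix Q N ℂ := (1 : Matrix N N ℂ).submatrix d id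
  have hS1 : ∀ (A : Matrix P N ℂ) i c, (S * A) (s i) c = A i c := by
    intro A i c
    simp [S, Matrix.mul_apply, Matrix.one_apply, hs.eq_iff]
  have hS1' : ∀ (A : Matrix P Q ℂ) i c, (S * A) (s i) c = A i c := by
    intro A i c
    simp [S, Matrix.mul_apply, Matrix.one_apply, hs.eq_iff]
  have hS2 : ∀ (A : Matrix P N ℂ) r c, (∀ i, r ≠ s i) → (S * A) r c = 0 := by
    intro A r c hr
    simp [S, Matrix.mul_apply, hr]
  have hS2' : ∀ (A : Matrix P Q ℂ) r c, (∀ i, r ≠ s i) → (S * A) r c = 0 := by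
    intro A r c hr
    simp [S, Matrix.mul_apply, hr]
  have hD1 : ∀ (A : Matrix N Q ℂ) r j, (A * D) r (d j) = A r j := by
    intro A r j
    simp [D, Matrix.mul_apply, Matrix.one_apply, hd.eq_iff]
  have hD2 : ∀ (A : Matrix N Q ℂ) r c, (∀ j, c ≠ d j) → (A * D) r c = 0 := by
    intro A r c hc
    simp [D, Matrix.mul_apply, fun j => (hc j).symm]
  -- `u` corrects the rows `s i` and `v` the columns `d j`; `W` adjusts for the double correction
  -- where they meet, so that `Z` appears there.
  let u : Matrix P N ℂ := X - B.submatrix s id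
  let W : Matrix P Q ℂ := Z - u.submatrix id d
  let v : Matrix N Q ℂ := S * W - B.submatrix id d
  have hY : Y = B + Matrix.fromCols S v * Matrix.fromRows u D := by
    rw [Matrix.fromCols_mul_fromRows]
    ext r c
    simp only [Matrix.add_apply]
    by_cases hr : ∃ i, r = s i
    · obtain ⟨i, rfl⟩ := hr
      rw [hS1]
      by_cases hc : ∃ j, c = d j
      · obtain ⟨j, rfl⟩ := hc
        rw [hD1, h11]
        simp only [v, Matrix.sub_apply, hS1', W, u, Matrix.submatrix_apply, id]
        ring
      · push Not at hc
        rw [hD2 _ _ _ hc, h12 i c hc]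
        simp [u]
    · push Not at hr
      rw [hS2 _ _ _ hr]
      by_cases hc : ∃ j, c = d j
      · obtain ⟨j, rfl⟩ := hc
        rw [hD1, h21 r j hr]
        simp only [v, Matrix.sub_apply, hS2' _ _ _ hr, Matrix.submatrix_apply, id]
        ring
      · push Not at hc
        rw [hD2 _ _ _ hc, h22 r c hr hc]
        ring
  set G := (X * F).submatrix id s with hG
  set K := F.submatrix d s with hK
  have hDF : D * F * S = K := by rw [one_submatrix_mul, mul_one_submatrix]; rfl
  have hSF : F * B.submatrix id d = (1 : Matrix N N ℂ).submatrix id d := by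
    ext i j
    rw [← hFB]
    rfl
  have huF : u * F = X * F - (1 : Matrix N N ℂ).submatrix s id := by
    rw [← hBF]
    exact Matrix.sub_mul _ _ _
  have huFS : u * F * S = G - 1 := by
    rw [huF, Matrix.sub_mul, mul_one_submatrix, mul_one_submatrix,
      Matrix.submatrix_submatrix]
    congr 1
    exact Matrix.submatrix_one s hs
  have hFv : F * v = F * S * W - (1 : Matrix N N ℂ).submatrix id d := by
    rw [Matrix.mul_sub, hSF, Matrix.mul_assoc]
  have hu1 := mul_one_submatrix u d
  have huFv : u * F * v = G * W - Z := by
    rw [Matrix.mul_assoc, hFv, Matrix.mul_sub, hu1, ← Matrix.mul_assoc, ← Matrix.mul_assoc, huFS,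
      Matrix.sub_mul, Matrix.one_mul]
    simp only [W]
    abel
  have hDFv : D * F * v = K * W - 1 := by
    rw [Matrix.mul_assoc, hFv, Matrix.mul_sub, ← Matrix.mul_assoc, ← Matrix.mul_assoc, hDF,
      one_submatrix_mul, Matrix.submatrix_submatrix]
    congr 1
    exact Matrix.submatrix_one d hd
  -- The blocks are `G`, `G W - Z`, `K`, `K W`; a unipotent column operation removes `W`, and the
  -- remaining `-1` block supplies the sign.
  have hblock : 1 + Matrix.fromRows u D * F * Matrix.fromCols S v =
      Matrix.fromBlocks G Z K 0 * Matrix.fromBlocks 1 0 0 (-1) * Matrix.fromBlocks 1 W 0 1 := by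
    rw [Matrix.fromRows_mul, Matrix.fromRows_mul_fromCols, huFS, huFv, hDF, hDFv,
      ← Matrix.fromBlocks_one, Matrix.fromBlocks_add, Matrix.fromBlocks_multiply,
      Matrix.fromBlocks_multiply]
    congr 1
    · simp
    · simp [sub_eq_add_neg]
    · simp
    · simp
  rw [hY, Matrix.det_add_mul _ _ (by rw [hB]; exact isUnit_one), hB, one_mul,
    Matrix.inv_eq_left_inv hFB, hblock, Matrix.det_mul, Matrix.det_mul,
    Matrix.det_fromBlocks_zero₂₁, Matrix.det_fromBlocks_zero₂₁, Matrix.det_neg]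
  simp [mul_comm]

/-! ### The inverse of the matrix of row sums. -/

/-- The row sums between the contents `-1, …, -n`. -/
def rowMatrix (a : ℤ → ℂ) (M n : ℕ) : Matrix (Fin n) (Fin n) ℂ :=
  Matrix.of fun i j => rowSum a M (-1 - (i : ℕ)) (-1 - (j : ℕ))

/-- The signed column sums between the contents `-1, …, -n`. -/
def colMatrix (a : ℤ → ℂ) (M n : ℕ) : Matrix (Fin n) (Fin n) ℂ :=
  Matrix.of fun i j => (-1) ^ ((i : ℕ) + (j : ℕ)) * colSum a M (-1 - (i : ℕ)) (-1 - (j : ℕ))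

theorem det_rowMatrix (a : ℤ → ℂ) (M n : ℕ) : (rowMatrix a M n).det = 1 := by
  rw [Matrix.det_of_isUpperTriangular]
  · simp [rowMatrix, rowSum_self]
  · intro i j hij
    have h : (j : ℕ) < i := hij
    exact rowSum_of_lt a M (by omega)

/-- A weighted form of `∑ (-1)^i e_i h_{n-i} = 0`. With `T` the bidiagonal matrix of the weights of
`M + 1`, the row matrices satisfy `R_M = T R_{M+1}` and the column matrices `C_{M+1} = C_M T`, so
the product does not depend on `M`. -/
theorem colMatrix_mul_rowMatrix (a : ℤ → ℂ) (M n : ℕ) :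
    colMatrix a M n * rowMatrix a M n = 1 := by
  induction M with
  | zero =>
    have h1 : colMatrix a 0 n = 1 := by
      ext i j
      rw [colMatrix, Matrix.of_apply, Matrix.one_apply]
      split_ifs with h
      · subst h
        rw [colSum_self, ← two_mul, pow_mul]
        simp
      · have : (i : ℕ) ≠ j := fun h' => h (Fin.ext h')
        rw [colSum_zero_of_ne a (by omega), mul_zero]
    have h2 : rowMatrix a 0 n = 1 := by
      ext i j
      rw [rowMatrix, Matrix.of_apply, Matrix.one_apply]
      split_ifs with h
      · rw [h, rowSum_self]
      · have : (i : ℕ) ≠ j := fun h' => h (Fin.ext h')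
        exact rowSum_zero_of_ne a (by omega)
    rw [h1, h2, one_mul]
  | succ M ih =>
    let c : ℕ → ℂ := fun i => weight a (M + 1) (-1 - i)
    have h1 : rowMatrix a M n = bidiag n c * rowMatrix a (M + 1) n := by
      ext i j
      have := bidiag_mul_apply c
        (fun (i : ℕ) (j : Fin n) => rowSum a (M + 1) (-1 - i) (-1 - (j : ℕ)))
        (fun j => rowSum_of_lt a _ (by omega)) i j
      refine Eq.trans ?_ this.symm
      have e : (-1 - ((i : ℕ) + 1 : ℕ) : ℤ) = -1 - (i : ℕ) - 1 := by push_cast; ring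
      simp only [c]
      rw [rowMatrix, Matrix.of_apply, rowSum_succ a M, e]
      ring
    have h2 : colMatrix a (M + 1) n = colMatrix a M n * bidiag n c := by
      ext i j
      have := mul_bidiag_apply c
        (fun (i : Fin n) (j : ℕ) => (-1) ^ ((i : ℕ) + j + 1) * colSum a M (-1 - (i : ℕ)) (-j))
        (fun i => by rw [colSum_of_lt a _ (by omega), mul_zero]) i j
      have e : (-1 - (j : ℕ) : ℤ) = -((j : ℕ) + 1 : ℕ) := by push_cast; ring
      have hcol : colMatrix a M n = Matrix.of fun i j : Fin n => (-1) ^ ((i : ℕ) + (j + 1) + 1) *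
          colSum a M (-1 - (i : ℕ)) (-((j : ℕ) + 1 : ℕ)) := by
        ext i j
        rw [colMatrix, Matrix.of_apply, Matrix.of_apply]
        congr 1
        · ring
        · congr 1
          push_cast
          ring
      rw [hcol]
      refine Eq.trans ?_ this.symm
      rw [colMatrix, Matrix.of_apply, colSum_succ, e]
      have e2 : (-((j : ℕ) + 1 : ℕ) + 1 : ℤ) = -(j : ℕ) := by push_cast; ring
      rw [e2]
      by_cases hj : 0 < (j : ℕ)
      · have e3 : c (j - 1) = weight a (M + 1) (-(j : ℕ)) := by
          simp only [c]
          congr 1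
          omega
        rw [e3]
        ring
      · have h0 : colSum a M (-1 - (i : ℕ)) (-(j : ℕ)) = 0 := colSum_of_lt a _ (by omega)
        rw [h0]
        ring
    rw [h2, Matrix.mul_assoc, ← h1, ih]

/-! ### The permutation attached to the Frobenius notation. -/

/-- For a row ending left of the diagonal, the distance of its end from the diagonal;
for the other rows the leg length. -/
def legOrGap (lam : YoungDiagram) (i : ℕ) : ℕ :=
  if i < diagLen lam then lam.colLen i - (i + 1) else i - lam.rowLen i

theorem legOrGap_lt_iff {lam : YoungDiagram} {i j : ℕ} (hij : i < j) :
    (legOrGap lam j < legOrGap lam i ↔ (j, i) ∈ lam) ∧ legOrGap lam i ≠ legOrGap lam j := by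
  have hi := lt_diagLen_iff lam i
  have hj := lt_diagLen_iff lam j
  have hic := hi
  have hjc := hj
  rw [YoungDiagram.mem_iff_lt_rowLen] at hi hj
  rw [YoungDiagram.mem_iff_lt_colLen] at hic hjc
  have h1 := @YoungDiagram.mem_iff_lt_rowLen lam j i
  have h2 := @YoungDiagram.mem_iff_lt_colLen lam j i
  have h3 := lam.rowLen_anti i j hij.le
  have h4 := lam.colLen_anti i j hij.le
  unfold legOrGap
  rw [h1] at h2 ⊢
  split_ifs <;> omega

theorem colLen_le {lam : YoungDiagram} {n : ℕ} (hn : lam.rowLen n = 0) (i : ℕ) :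
    lam.colLen i ≤ n := by
  by_contra! h
  rw [← YoungDiagram.mem_iff_lt_colLen, YoungDiagram.mem_iff_lt_rowLen] at h
  omega

theorem diagLen_le {lam : YoungDiagram} {n : ℕ} (hn : lam.rowLen n = 0) : diagLen lam ≤ n := by
  by_contra! h
  rw [lt_diagLen_iff, YoungDiagram.mem_iff_lt_rowLen] at h
  omega

theorem legOrGap_lt {lam : YoungDiagram} {n i : ℕ} (hn : lam.rowLen n = 0) (hi : i < n) :
    legOrGap lam i < n := by
  have := colLen_le hn i
  unfold legOrGap
  split_ifs <;> omega

/-- The permutation of the rows given by `legOrGap`. -/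
def legPerm {lam : YoungDiagram} {n : ℕ} (hn : lam.rowLen n = 0) : Equiv.Perm (Fin n) :=
  Equiv.ofBijective (fun i => ⟨legOrGap lam i, legOrGap_lt hn i.2⟩) <| by
    rw [← Finite.injective_iff_bijective]
    intro i j h
    have h' : legOrGap lam i = legOrGap lam j := congrArg Fin.val h
    rcases lt_trichotomy (i : ℕ) j with hij | hij | hij
    · exact absurd h' (legOrGap_lt_iff hij).2
    · exact Fin.ext hij
    · exact absurd h'.symm (legOrGap_lt_iff hij).2

theorem legPerm_apply {lam : YoungDiagram} {n : ℕ} (hn : lam.rowLen n = 0) (i : Fin n) :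
    (legPerm hn i : ℕ) = legOrGap lam i := rfl

/-- The inversions of `legPerm` are the boxes below the diagonal. -/
theorem sign_legPerm {lam : YoungDiagram} {n : ℕ} (hn : lam.rowLen n = 0) :
    (((legPerm hn).sign : ℤ) : ℂ) = ∏ i, (-1) ^ frobLeg lam i := by
  have h1 : ∀ i : Fin n, (∏ j ∈ Ioi i, if legPerm hn i < legPerm hn j then (1 : ℤˣ) else -1) =
      (-1) ^ (lam.colLen i - (i + 1)) := by
    intro i
    have h2 : ∀ j ∈ Ioi i, (if legPerm hn i < legPerm hn j then (1 : ℤˣ) else -1) =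
        if (j : ℕ) < lam.colLen i then -1 else 1 := by
      intro j hj
      have hij : (i : ℕ) < j := by simpa using hj
      have h3 := legOrGap_lt_iff (lam := lam) hij
      rw [YoungDiagram.mem_iff_lt_colLen] at h3
      have h5 : legPerm hn i < legPerm hn j ↔ ¬ (j : ℕ) < lam.colLen i := by
        rw [Fin.lt_def, legPerm_apply, legPerm_apply]
        omega
      simp only [h5, ite_not]
    rw [prod_congr rfl h2, ← prod_filter, prod_const]
    congr 1
    have hc := colLen_le hn i
    have h4 : ((Ioi i).filter fun j : Fin n => (j : ℕ) < lam.colLen i).card =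
        (Ico ((i : ℕ) + 1) (lam.colLen i)).card := by
      rw [← card_map Fin.valEmbedding]
      congr 1
      ext x
      simp only [mem_map, mem_filter, mem_Ioi, Fin.valEmbedding_apply, mem_Ico, Fin.lt_def]
      constructor
      · rintro ⟨j, h, rfl⟩
        omega
      · intro h
        exact ⟨⟨x, by omega⟩, by simpa using ⟨by omega, h.2⟩, rfl⟩
    rw [h4, Nat.card_Ico]
  rw [Equiv.Perm.sign_eq_prod_prod_Ioi, prod_congr rfl fun i _ => h1 i]
  push_cast
  rw [Fin.prod_univ_eq_prod_range (fun i => (-1 : ℂ) ^ (lam.colLen i - (i + 1))) n]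
  simp only [frobLeg]
  rw [Fin.prod_univ_eq_prod_range (fun i => (-1 : ℂ) ^ (lam.colLen i - (i + 1))) (diagLen lam)]
  symm
  refine prod_subset (range_subset_range.2 (diagLen_le hn)) fun i _ hi => ?_
  rw [mem_range, lt_diagLen_iff, YoungDiagram.mem_iff_lt_colLen] at hi
  -- Beyond the diagonal boxes the truncated difference is `0`, so these rows add no inversions.
  rw [Nat.sub_eq_zero_of_le (by omega), pow_zero]

/-- The leg lengths as indices below the number of rows. -/
def legIndex {lam : YoungDiagram} {n : ℕ} (hn : lam.rowLen n = 0) (i : Fin (diagLen lam)) : Fin n :=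
  legPerm hn (Fin.castLE (diagLen_le hn) i)

theorem legIndex_val {lam : YoungDiagram} {n : ℕ} (hn : lam.rowLen n = 0)
    (i : Fin (diagLen lam)) : (legIndex hn i : ℕ) = frobLeg lam i := by
  rw [legIndex, legPerm_apply, legOrGap, Fin.val_castLE, if_pos i.2, frobLeg]

theorem legIndex_injective {lam : YoungDiagram} {n : ℕ} (hn : lam.rowLen n = 0) :
    (legIndex hn).Injective :=
  (legPerm hn).injective.comp (Fin.castLE_injective _)

theorem pos_symm_legIndex {lam : YoungDiagram} {n : ℕ} (hn : lam.rowLen n = 0)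
    (i : Fin (diagLen lam)) : pos lam ((legPerm hn).symm (legIndex hn i)) = frobArm lam i := by
  have := (lt_diagLen_iff lam i).1 i.2
  rw [YoungDiagram.mem_iff_lt_rowLen] at this
  rw [legIndex, Equiv.symm_apply_apply, Fin.val_castLE, pos, frobArm]
  omega

/-- This makes the reordered Jacobi–Trudi matrix agree with `rowMatrix` away from the leg indices.
-/
theorem pos_symm_of_ne_legIndex {lam : YoungDiagram} {n : ℕ} (hn : lam.rowLen n = 0)
    (k : Fin n) (hk : ∀ i, k ≠ legIndex hn i) : pos lam ((legPerm hn).symm k) = -1 - (k : ℕ) := by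
  obtain ⟨i, rfl⟩ := (legPerm hn).surjective k
  have hi : ¬ (i : ℕ) < diagLen lam := fun h => hk ⟨i, h⟩ rfl
  have hi' := hi
  rw [lt_diagLen_iff, YoungDiagram.mem_iff_lt_rowLen] at hi'
  rw [Equiv.symm_apply_apply, legPerm_apply, legOrGap, if_neg hi, pos]
  omega

/-! ### Hooks and the Giambelli determinant. -/

/-- Up to sign the sum over the tableaux of shape `(α | β)`, when `β < n`. -/
def hookEntry (a : ℤ → ℂ) (M n : ℕ) (α : ℕ) (β : Fin n) : ℂ :=
  ((Matrix.of fun (_ : Unit) (j : Fin n) => rowSum a M α (-1 - (j : ℕ))) * colMatrix a M n) () β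

theorem diagZeta_eq_det_frobenius (a : ℤ → ℂ) (M : ℕ) {n : ℕ} {lam mu : YoungDiagram}
    (hmu : mu ≤ lam) (hn : lam.rowLen n = 0) (hn' : mu.rowLen n = 0) :
    diagZeta M lam mu a = (∏ i, (-1) ^ frobLeg lam i) * (∏ i, (-1) ^ frobLeg mu i) *
      ((-1) ^ diagLen mu * (Matrix.fromBlocks
        (Matrix.of fun i j => hookEntry a M n (frobArm lam i) (legIndex hn j))
        (Matrix.of fun i j => rowSum a M (frobArm lam i) (frobArm mu j))
        ((colMatrix a M n).submatrix (legIndex hn') (legIndex hn)) 0).det) := by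
  have h := det_replace_rows_cols
    (Y := Matrix.of fun k l : Fin n =>
      rowSum a M (pos lam ((legPerm hn).symm k)) (pos mu ((legPerm hn').symm l)))
    (colMatrix_mul_rowMatrix a M n) (det_rowMatrix a M n)
    (legIndex_injective hn) (legIndex_injective hn')
    (Matrix.of fun i (j : Fin n) => rowSum a M (frobArm lam i) (-1 - (j : ℕ)))
    (Matrix.of fun i j => rowSum a M (frobArm lam i) (frobArm mu j))
    (fun i j => by simp only [Matrix.of_apply, pos_symm_legIndex])
    (fun i c hc => by
      simp only [Matrix.of_apply, pos_symm_legIndex, pos_symm_of_ne_legIndex hn' c hc])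
    (fun r j hr => by
      simp only [Matrix.of_apply, pos_symm_legIndex, pos_symm_of_ne_legIndex hn r hr]
      -- The row ends left of the diagonal, whereas the arm length of `mu` is nonnegative.
      exact rowSum_of_lt a M (by omega))
    (fun r c hr hc => by
      simp only [Matrix.of_apply, pos_symm_of_ne_legIndex hn r hr,
        pos_symm_of_ne_legIndex hn' c hc, rowMatrix])
  rw [Fintype.card_fin] at h
  refine Eq.trans ?_ (congrArg _ h)
  rw [diagZeta_eq_det a M hmu hn, ← sign_legPerm hn, ← sign_legPerm hn', mul_assoc,
    ← Matrix.det_permute', ← Matrix.det_permute]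
  congr 1
  ext i j
  simp

theorem mem_hook {α β i j : ℕ} : (i, j) ∈ hook α β ↔ i = 0 ∧ j ≤ α ∨ i ≤ β ∧ j = 0 := by
  rw [← YoungDiagram.mem_cells]
  simp [hook]
  omega

theorem rowLen_hook {α β n : ℕ} (h : β < n) : (hook α β).rowLen n = 0 := by
  by_contra hne
  have := YoungDiagram.mem_iff_lt_rowLen.2 (Nat.pos_of_ne_zero hne)
  rw [mem_hook] at this
  omega

theorem diagLen_hook (α β : ℕ) : diagLen (hook α β) = 1 := by
  have h0 := lt_diagLen_iff (hook α β) 0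
  have h1 := lt_diagLen_iff (hook α β) 1
  rw [mem_hook] at h0 h1
  omega

theorem diagLen_bot : diagLen ⊥ = 0 := by
  have h0 := lt_diagLen_iff ⊥ 0
  exact Nat.eq_zero_of_not_pos fun h => YoungDiagram.notMem_bot _ (h0.1 h)

theorem frobArm_hook {α β : ℕ} (i : Fin (diagLen (hook α β))) : frobArm (hook α β) i = α := by
  have hi : (i : ℕ) = 0 := by have := i.2; have := diagLen_hook α β; omega
  have h1 := (@YoungDiagram.mem_iff_lt_rowLen (hook α β) 0 α).symm
  have h2 := (@YoungDiagram.mem_iff_lt_rowLen (hook α β) 0 (α + 1)).symm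
  rw [mem_hook] at h1 h2
  rw [frobArm, hi]
  omega

theorem frobLeg_hook {α β : ℕ} (i : Fin (diagLen (hook α β))) : frobLeg (hook α β) i = β := by
  have hi : (i : ℕ) = 0 := by have := i.2; have := diagLen_hook α β; omega
  have h1 := (@YoungDiagram.mem_iff_lt_colLen (hook α β) β 0).symm
  have h2 := (@YoungDiagram.mem_iff_lt_colLen (hook α β) (β + 1) 0).symm
  rw [mem_hook] at h1 h2
  rw [frobLeg, hi]
  omega

/-- No hook tableaux are enumerated: a hook has one diagonal box, so over the empty diagram the
block determinant is a single entry. -/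
theorem diagZeta_hook (a : ℤ → ℂ) (M : ℕ) {n : ℕ} (α : ℕ) (β : Fin n) :
    diagZeta M (hook α β) ⊥ a = hookEntry a M n α β * (-1) ^ (β : ℕ) := by
  have hb : (⊥ : YoungDiagram).rowLen n = 0 := by
    by_contra hne
    exact YoungDiagram.notMem_bot _ (YoungDiagram.mem_iff_lt_rowLen.2 (Nat.pos_of_ne_zero hne))
  have hn := rowLen_hook (α := α) β.2
  have i₀ : Fin (diagLen (hook α β)) := ⟨0, by rw [diagLen_hook]; exact Nat.one_pos⟩
  have hc : Fintype.card (Fin (diagLen (hook α β)) ⊕ Fin (diagLen ⊥)) = 1 := by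
    rw [Fintype.card_sum, Fintype.card_fin, Fintype.card_fin, diagLen_hook, diagLen_bot]
  have hβ : legIndex hn i₀ = β := Fin.ext (by rw [legIndex_val, frobLeg_hook])
  have hp : ∏ i : Fin (diagLen (⊥ : YoungDiagram)), (-1 : ℂ) ^ frobLeg ⊥ i = 1 :=
    prod_eq_one fun i _ => absurd (i.2.trans_eq diagLen_bot) (Nat.not_lt_zero _)
  rw [diagZeta_eq_det_frobenius a M bot_le hn hb, Matrix.det_eq_elem_of_card_eq_one hc (Sum.inl i₀),
    Matrix.fromBlocks_apply₁₁, Matrix.of_apply, hβ, frobArm_hook, hp, diagLen_bot,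
    prod_congr rfl fun i _ => congrArg _ (frobLeg_hook i), prod_const, card_univ,
    Fintype.card_fin, diagLen_hook]
  ring

/-- The skew Giambelli formula. -/
theorem diagZeta_eq_det_giambelliMatrix (M : ℕ) (lam mu : YoungDiagram) (hmu : mu ≤ lam) (a : ℤ → ℂ) :
    diagZeta M lam mu a =
      (-1 : ℂ) ^ diagLen mu * (giambelliMatrix M lam mu a).det := by
  have hn : lam.rowLen (lam.colLen 0) = 0 := by
    by_contra hne
    have := YoungDiagram.mem_iff_lt_rowLen.2 (Nat.pos_of_ne_zero hne)
    exact lt_irrefl _ (YoungDiagram.mem_iff_lt_colLen.1 this)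
  have hn' : mu.rowLen (lam.colLen 0) = 0 := Nat.le_zero.1 ((rowLen_mono hmu _).trans_eq hn)
  -- The signs of `hookEntry` and `colMatrix` are absorbed by scaling rows by the leg signs of `mu`
  -- and columns by those of `lam`; the determinants of these scalings are the prefactors in
  -- `diagZeta_eq_det_frobenius`.
  have hG : giambelliMatrix M lam mu a =
      Matrix.diagonal (Sum.elim (fun _ => 1) fun i => (-1) ^ frobLeg mu i) *
        Matrix.fromBlocks
          (Matrix.of fun i j => hookEntry a M _ (frobArm lam i) (legIndex hn j))
          (Matrix.of fun i j => rowSum a M (frobArm lam i) (frobArm mu j))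
          ((colMatrix a M _).submatrix (legIndex hn') (legIndex hn)) 0 *
        Matrix.diagonal (Sum.elim (fun j => (-1) ^ frobLeg lam j) fun _ => 1) := by
    ext (i | i) (j | j)
    · rw [Matrix.mul_diagonal, Matrix.diagonal_mul]
      simp only [giambelliMatrix, Matrix.fromBlocks_apply₁₁, Matrix.of_apply, Sum.elim_inl,
        one_mul]
      rw [← legIndex_val hn, diagZeta_hook]
    · rw [Matrix.mul_diagonal, Matrix.diagonal_mul]
      simp [giambelliMatrix, rowSum]
    · rw [Matrix.mul_diagonal, Matrix.diagonal_mul]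
      simp only [giambelliMatrix, Matrix.fromBlocks_apply₂₁, Matrix.of_apply, Sum.elim_inl,
        Sum.elim_inr, Matrix.submatrix_apply, colMatrix, legIndex_val, pow_add, colSum]
      have h1 : (-1 - (frobLeg mu i : ℤ)) - (-1 - (frobLeg lam j : ℤ)) =
        frobLeg lam j - frobLeg mu i := by ring
      have h2 : -(frobLeg mu i : ℤ) - 1 = -1 - frobLeg mu i := by ring
      have h3 : ∀ k : ℕ, (-1 : ℂ) ^ k * (-1) ^ k = 1 := fun k => by
        rw [← mul_pow]
        simp
      rw [h1, h2]
      set C := colZeta M (frobLeg lam j - frobLeg mu i) (shift (-1 - frobLeg mu i) a)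
      linear_combination (-C) * ((-1) ^ frobLeg lam j * (-1) ^ frobLeg lam j) * h3 (frobLeg mu i) -
        C * h3 (frobLeg lam j)
    · rw [Matrix.mul_diagonal, Matrix.diagonal_mul]
      simp [giambelliMatrix]
  rw [diagZeta_eq_det_frobenius a M hmu hn hn', hG, Matrix.det_mul, Matrix.det_mul,
    Matrix.det_diagonal, Matrix.det_diagonal, Fintype.prod_sum_type, Fintype.prod_sum_type]
  simp only [Sum.elim_inl, Sum.elim_inr, prod_const_one]
  ring

end SchurZeta

end

theorem mainTheorem12 (M : ℕ) (lam mu : YoungDiagram) (hmu : mu ≤ lam) (a : ℤ → ℂ) :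
    SchurZeta.diagZeta M lam mu a =
      (-1 : ℂ) ^ SchurZeta.diagLen mu * (SchurZeta.giambelliMatrix M lam mu a).det := by
  exact SchurZeta.diagZeta_eq_det_giambelliMatrix M lam mu hmu a
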